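/- Notation. For $\kappa>0$ let $T_\kappa:\mathbb R\to[-\kappa,\kappa]$, $T_\kappa(x)=\max(-\kappa,\min(x,\kappa))$, be the cutoff function. For probability measures $\mu,\nu$ on $\mathbb R$ let $\Gamma(\mu,\nu)$ be the set of all couplings, i.e. the probability measures on $\mathbb R^2$ with marginals $\mu$ and $\nu$, and put $$W_{2,\kappa}(\mu,\nu)=\inf_{\eta\in\Gamma(\mu,\nu)}\Bigl(\int_{\mathbb R^2}T_\kappa(x-y)^2\,d\eta(x,y)\Bigr)^{1/2},$$ the Wasserstein $2$-distance for the metric $d(x,y)=|T_\kappa(x-y)|$. Let $(\mu_n)_{n\ge 1}$ be a sequence of probability measures on $\mathbb R$. Put $(\Omega,\mu)=\prod_{k\ge 1}(\mathbb R,\mu_k)$ and $(\Omega_n,\tilde\mu_n)=\prod_{k\ge n+1}(\mathbb R,\mu_k)$ for $n\ge 0$, and let $\mathbb R$ carry the Lebesgue measure class. The maps $\pi_n:\mathbb R\times\Omega\to\mathbb R\times\Omega_n$, $\pi_n(t,\omega)=(t+\omega_1+\dots+\omega_n,\ \omega_{n+1},\omega_{n+2},\dots)$, are nonsingular. Let $A_n=\{F\circ\pi_n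 : F\in L^\infty(\mathbb R\times\Omega_n)\}\subset L^\infty(\mathbb R\times\Omega)$. The *tail boundary* of $(\mu_n)$ is the algebra $A=\bigcap_{n\ge 0}A_n$, and the *tail boundary flow* of $(\mu_n)$ is the action of $\mathbb R$ on $A$ by translation in the first variable. Two tail boundary flows $\mathbb R\curvearrowright A$ and $\mathbb R\curvearrowright C$ are *isomorphic* if there is a $*$-isomorphism $A\to C$ that intertwines the two actions of $\mathbb R$. **Proposition.** Let $(\mu_n)_{n\ge 1}$ and $(\nu_n)_{n\ge 1}$ be sequences of probability measures on $\mathbb R$ such that, for some $\kappa>0$, $$\sum_{n=1}^\infty W_{2,\kappa}(\mu_n,\nu_n)^2<+\infty .$$ Then the tail boundary flows of $(\mu_n)$ and $(\nu_n)$ are isomorphic. -/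

import Mathlib

open MeasureTheory MeasureTheory.Measure

namespace TailBoundary

/-! ### The `*`-algebra of measurable functions modulo null sets -/

section MeasurableFunctions

variable {X Y : Type*} [MeasurableSpace X] [MeasurableSpace Y]

noncomputable instance instCommRingAEEqFun (m : Measure X) : CommRing (X →ₘ[m] ℂ) :=
  { AEEqFun.instAddCommGroup, AEEqFun.instCommMonoid with
    left_distrib := fun a b c => AEEqFun.induction_on₃ a b c fun f hf g hg h hh => by
      simp only [AEEqFun.mk_add_mk, AEEqFun.mk_mul_mk, mul_add]
    right_distrib := fun a b c => AEEqFun.induction_on₃ a b c fun f hf g hg h hh => by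
      simp only [AEEqFun.mk_add_mk, AEEqFun.mk_mul_mk, add_mul]
    zero_mul := fun a => AEEqFun.induction_on a fun f hf => by
      simp only [AEEqFun.zero_def, AEEqFun.mk_mul_mk]
      exact AEEqFun.mk_eq_mk.2 (Filter.Eventually.of_forall fun x => by simp)
    mul_zero := fun a => AEEqFun.induction_on a fun f hf => by
      simp only [AEEqFun.zero_def, AEEqFun.mk_mul_mk]
      exact AEEqFun.mk_eq_mk.2 (Filter.Eventually.of_forall fun x => by simp) }

noncomputable instance instAlgebraAEEqFun (m : Measure X) : Algebra ℂ (X →ₘ[m] ℂ) :=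
  Algebra.ofModule
    (fun r a b => AEEqFun.induction_on₂ a b fun f _ g _ =>
      AEEqFun.mk_eq_mk.2 (Filter.Eventually.of_forall fun x => smul_mul_assoc r (f x) (g x)))
    (fun r a b => AEEqFun.induction_on₂ a b fun f _ g _ =>
      AEEqFun.mk_eq_mk.2 (Filter.Eventually.of_forall fun x => mul_smul_comm r (f x) (g x)))

noncomputable instance instStarRingAEEqFun (m : Measure X) : StarRing (X →ₘ[m] ℂ) where
  star_mul a b := by
    ext
    filter_upwards [AEEqFun.coeFn_star (a * b), AEEqFun.coeFn_mul a b,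
      AEEqFun.coeFn_mul (star b) (star a), AEEqFun.coeFn_star a, AEEqFun.coeFn_star b]
      with x h1 h2 h3 h4 h5
    rw [h1, h3]
    simp [h2, h4, h5, mul_comm]
  star_add a b := by
    ext
    filter_upwards [AEEqFun.coeFn_star (a + b), AEEqFun.coeFn_add a b,
      AEEqFun.coeFn_add (star a) (star b), AEEqFun.coeFn_star a, AEEqFun.coeFn_star b]
      with x h1 h2 h3 h4 h5
    rw [h1, h3]
    simp [h2, h4, h5]

instance instStarModuleAEEqFun (m : Measure X) : StarModule ℂ (X →ₘ[m] ℂ) where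
  star_smul r a := by
    ext
    filter_upwards [AEEqFun.coeFn_star (r • a), AEEqFun.coeFn_smul r a,
      AEEqFun.coeFn_smul (star r) (star a), AEEqFun.coeFn_star a]
      with x h1 h2 h3 h4
    rw [h1, h3]
    simp [h2, h4]

theorem coeFn_algebraMap (m : Measure X) (r : ℂ) :
    (algebraMap ℂ (X →ₘ[m] ℂ) r : X → ℂ) =ᵐ[m] fun _ => r := by
  rw [Algebra.algebraMap_eq_smul_one]
  filter_upwards [AEEqFun.coeFn_smul r (1 : X →ₘ[m] ℂ), AEEqFun.coeFn_one (α := X) (β := ℂ) (μ := m)]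
    with x h1 h2
  simp [h1, h2]

/-- `L^∞(X, m)`: classes modulo null sets of essentially bounded complex functions. -/
noncomputable def Linfty (m : Measure X) : StarSubalgebra ℂ (X →ₘ[m] ℂ) where
  carrier := {f | ∃ C : ℝ, ∀ᵐ x ∂m, ‖f x‖ ≤ C}
  mul_mem' := by
    rintro a b ⟨C, hC⟩ ⟨D, hD⟩
    refine ⟨C * D, ?_⟩
    filter_upwards [hC, hD, AEEqFun.coeFn_mul a b] with x h1 h2 h3
    rw [h3, Pi.mul_apply, norm_mul]
    exact mul_le_mul h1 h2 (norm_nonneg _) ((norm_nonneg _).trans h1)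
  add_mem' := by
    rintro a b ⟨C, hC⟩ ⟨D, hD⟩
    refine ⟨C + D, ?_⟩
    filter_upwards [hC, hD, AEEqFun.coeFn_add a b] with x h1 h2 h3
    rw [h3, Pi.add_apply]
    exact (norm_add_le _ _).trans (add_le_add h1 h2)
  algebraMap_mem' r := by
    refine ⟨‖r‖, ?_⟩
    filter_upwards [coeFn_algebraMap m r] with x h
    rw [h]
  star_mem' := by
    rintro a ⟨C, hC⟩
    refine ⟨C, ?_⟩
    filter_upwards [hC, AEEqFun.coeFn_star a] with x h1 h2
    rw [h2, Pi.star_apply, norm_star]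
    exact h1

/-- The `*`-homomorphism `F ↦ F ∘ p` given by a nonsingular map `p`. -/
noncomputable def pullback {m : Measure X} {m' : Measure Y} (p : X → Y)
    (hp : QuasiMeasurePreserving p m m') : (Y →ₘ[m'] ℂ) →⋆ₐ[ℂ] (X →ₘ[m] ℂ) where
  toFun F := F.compQuasiMeasurePreserving p hp
  map_one' := rfl
  map_mul' a b := AEEqFun.induction_on₂ a b fun _ _ _ _ => rfl
  map_zero' := rfl
  map_add' a b := AEEqFun.induction_on₂ a b fun _ _ _ _ => rfl
  commutes' _ := rfl
  map_star' a := AEEqFun.induction_on a fun _ _ => rfl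

theorem pullback_comp {Z : Type*} [MeasurableSpace Z] {m : Measure X} {m' : Measure Y}
    {m'' : Measure Z} {p : X → Y} {q : Y → Z} (hp : QuasiMeasurePreserving p m m')
    (hq : QuasiMeasurePreserving q m' m'') (F : Z →ₘ[m''] ℂ) :
    pullback p hp (pullback q hq F) = pullback (q ∘ p) (hq.comp hp) F :=
  (AEEqFun.compQuasiMeasurePreserving_comp F hq hp).symm

theorem pullback_congr {m : Measure X} {m' : Measure Y} {p q : X → Y}
    (hp : QuasiMeasurePreserving p m m') (hq : QuasiMeasurePreserving q m m') (h : p = q)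
    (F : Y →ₘ[m'] ℂ) : pullback p hp F = pullback q hq F := by
  subst h
  rfl

theorem pullback_mem_Linfty {m : Measure X} {m' : Measure Y} {p : X → Y}
    (hp : QuasiMeasurePreserving p m m') {F : Y →ₘ[m'] ℂ} (hF : F ∈ Linfty m') :
    pullback p hp F ∈ Linfty m := by
  obtain ⟨C, hC⟩ := hF
  refine ⟨C, ?_⟩
  filter_upwards [hp.ae hC, AEEqFun.coeFn_compQuasiMeasurePreserving F hp] with x h1 h2
  change ‖(F.compQuasiMeasurePreserving p hp) x‖ ≤ C
  rw [h2]
  exact h1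

end MeasurableFunctions

/-! ### The time dependent random walk and its tail boundary -/

/-- The product of Lebesgue measure on `ℝ` (the starting point) and `∏ₖ μₖ` (the increments). All
that matters is the class of null sets, which is unchanged if Lebesgue measure is replaced by an
equivalent probability measure. -/
noncomputable def pathMeasure (μ : ℕ → Measure ℝ) [∀ k, IsProbabilityMeasure (μ k)] :
    Measure (ℝ × (ℕ → ℝ)) :=
  (volume : Measure ℝ).prod (infinitePi μ)

/-- `πₙ(t, ω) = (t + ω₀ + ⋯ + ωₙ₋₁, (ωₙ, ωₙ₊₁, …))`; the increments are numbered from `0`. -/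
def walk (n : ℕ) (x : ℝ × (ℕ → ℝ)) : ℝ × (ℕ → ℝ) :=
  (x.1 + ∑ k ∈ Finset.range n, x.2 k, fun k => x.2 (n + k))

/-- Translation by `s` in the first variable. -/
def translate (s : ℝ) (x : ℝ × (ℕ → ℝ)) : ℝ × (ℕ → ℝ) := (x.1 + s, x.2)

section Walk

variable (μ : ℕ → Measure ℝ) [∀ k, IsProbabilityMeasure (μ k)]

theorem measurePreserving_shift (n : ℕ) :
    MeasurePreserving (fun (ω : ℕ → ℝ) k => ω (n + k)) (infinitePi μ)
      (infinitePi fun k => μ (n + k)) := by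
  have hm : Measurable fun (ω : ℕ → ℝ) k => ω (n + k) := by fun_prop
  refine ⟨hm, eq_infinitePi _ fun s t ht => ?_⟩
  rw [Measure.map_apply hm (MeasurableSet.pi s.countable_toSet fun i _ => ht i)]
  have : (fun (ω : ℕ → ℝ) k => ω (n + k)) ⁻¹' (Set.pi s t) =
      Set.pi (s.map (addLeftEmbedding n)) fun j => t (j - n) := by
    ext ω
    simp [Set.mem_pi]
  rw [this, infinitePi_pi _ fun i _ => ht _, Finset.prod_map]
  simp

theorem measurePreserving_walk (n : ℕ) :
    MeasurePreserving (walk n) (pathMeasure μ) (pathMeasure fun k => μ (n + k)) := by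
  have h := (measurePreserving_shift μ n).skew_product (μc := (volume : Measure ℝ))
    (μd := (volume : Measure ℝ)) (g := fun ω t => t + ∑ k ∈ Finset.range n, ω k)
    (by simp only [Function.uncurry_def]; fun_prop)
    (Filter.Eventually.of_forall fun ω => (measurePreserving_add_right volume _).map_eq)
  exact (measurePreserving_swap.comp h).comp measurePreserving_swap

theorem measurePreserving_translate (s : ℝ) :
    MeasurePreserving (translate s) (pathMeasure μ) (pathMeasure μ) :=
  (measurePreserving_add_right volume s).prod (MeasurePreserving.id _)

/-- `Aₙ = (πₙ)_*(L^∞(ℝ × Ωₙ))`, the algebra of functions `F ∘ πₙ` with `F ∈ L^∞(ℝ × Ωₙ)`. -/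
noncomputable def tailAlgebra (n : ℕ) : StarSubalgebra ℂ ((ℝ × (ℕ → ℝ)) →ₘ[pathMeasure μ] ℂ) :=
  (Linfty (pathMeasure fun k => μ (n + k))).map
    (pullback (walk n) (measurePreserving_walk μ n).quasiMeasurePreserving)

/-- The tail boundary `A = ⋂ₙ Aₙ`. -/
noncomputable def tailBoundary : StarSubalgebra ℂ ((ℝ × (ℕ → ℝ)) →ₘ[pathMeasure μ] ℂ) :=
  ⨅ n : ℕ, tailAlgebra μ n

/-- The `*`-homomorphism `F ↦ ((t, ω) ↦ F (t - s, ω))`. -/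
noncomputable def translateHom (s : ℝ) :
    ((ℝ × (ℕ → ℝ)) →ₘ[pathMeasure μ] ℂ) →⋆ₐ[ℂ] ((ℝ × (ℕ → ℝ)) →ₘ[pathMeasure μ] ℂ) :=
  pullback (translate (-s)) (measurePreserving_translate μ (-s)).quasiMeasurePreserving

variable {μ}

theorem translateHom_mem (s : ℝ) {F : (ℝ × (ℕ → ℝ)) →ₘ[pathMeasure μ] ℂ}
    (hF : F ∈ tailBoundary μ) : translateHom μ s F ∈ tailBoundary μ := by
  refine StarSubalgebra.mem_iInf.2 fun n => ?_
  obtain ⟨G, hG, rfl⟩ := StarSubalgebra.mem_iInf.1 hF n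
  refine ⟨translateHom _ s G, pullback_mem_Linfty _ hG, ?_⟩
  have h1 := (measurePreserving_walk μ n).quasiMeasurePreserving
  have h2 := (measurePreserving_translate μ (-s)).quasiMeasurePreserving
  have h3 := (measurePreserving_translate (fun k => μ (n + k)) (-s)).quasiMeasurePreserving
  change pullback _ h1 (pullback _ h3 G) = pullback _ h2 (pullback _ h1 G)
  rw [pullback_comp, pullback_comp]
  refine pullback_congr (h3.comp h1) (h1.comp h2) (funext fun x => Prod.ext ?_ rfl) G
  simp only [Function.comp, walk, translate]
  ring

theorem translateHom_zero (F : (ℝ × (ℕ → ℝ)) →ₘ[pathMeasure μ] ℂ) : translateHom μ 0 F = F := by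
  have h : translate (-0) = id := by funext x; simp [translate]
  simp only [translateHom, h]
  exact AEEqFun.compQuasiMeasurePreserving_id F

theorem translateHom_add (s t : ℝ) (F : (ℝ × (ℕ → ℝ)) →ₘ[pathMeasure μ] ℂ) :
    translateHom μ (s + t) F = translateHom μ s (translateHom μ t F) := by
  have h : translate (-(s + t)) = translate (-t) ∘ translate (-s) := by
    funext x
    simp only [translate, Function.comp, Prod.mk.injEq, and_true]
    ring
  simp only [translateHom, pullback_comp, h]

variable (μ)

/-- The tail boundary flow: the action of `ℝ` on the tail boundary by translation in the first
variable. -/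
noncomputable def tailBoundaryFlow :
    Multiplicative ℝ →* (tailBoundary μ ≃⋆ₐ[ℂ] tailBoundary μ) where
  toFun s :=
    { toFun := fun F => ⟨translateHom μ s.toAdd F, translateHom_mem _ F.2⟩
      invFun := fun F => ⟨translateHom μ (-s.toAdd) F, translateHom_mem _ F.2⟩
      left_inv := fun F => Subtype.ext <| by
        change translateHom μ _ (translateHom μ _ _) = _
        rw [← translateHom_add, neg_add_cancel, translateHom_zero]
      right_inv := fun F => Subtype.ext <| by
        change translateHom μ _ (translateHom μ _ _) = _
        rw [← translateHom_add, add_neg_cancel, translateHom_zero]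
      map_mul' := fun F G => Subtype.ext <| map_mul (translateHom μ s.toAdd) _ _
      map_add' := fun F G => Subtype.ext <| map_add (translateHom μ s.toAdd) _ _
      map_star' := fun F => Subtype.ext <| map_star (translateHom μ s.toAdd) _
      map_smul' := fun r F => Subtype.ext <| map_smul (translateHom μ s.toAdd) r _ }
  map_one' := by
    ext F : 2
    exact translateHom_zero _
  map_mul' s t := by
    ext F : 2
    exact translateHom_add _ _ _

end Walk

/-- The tail boundary flows of `μ` and `ν` are isomorphic: some `*`-isomorphism between the tail
boundaries intertwines the two actions of `ℝ`. -/
def IsomorphicTailBoundaryFlows (μ ν : ℕ → Measure ℝ) [∀ k, IsProbabilityMeasure (μ k)]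
    [∀ k, IsProbabilityMeasure (ν k)] : Prop :=
  ∃ θ : tailBoundary μ ≃⋆ₐ[ℂ] tailBoundary ν, ∀ (s : Multiplicative ℝ) (F : tailBoundary μ),
    θ (tailBoundaryFlow μ s F) = tailBoundaryFlow ν s (θ F)

/-! ### The truncated Wasserstein distance -/

/-- The cutoff function `T_κ : ℝ → [-κ, κ]`. -/
noncomputable def cutoff (κ x : ℝ) : ℝ := max (-κ) (min x κ)

/-- `Γ(μ, ν)`: the probability measures on `ℝ²` with marginals `μ` and `ν`. -/
def couplings (μ ν : Measure ℝ) : Set (Measure (ℝ × ℝ)) :=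
  {η | IsProbabilityMeasure η ∧ η.map Prod.fst = μ ∧ η.map Prod.snd = ν}

/-- `W_{2,κ}(μ, ν)`: the infimum over all couplings `η` of `(∫ T_κ(x - y)² dη(x, y))^{1/2}`. -/
noncomputable def wasserstein (κ : ℝ) (μ ν : Measure ℝ) : ℝ :=
  sInf ((fun η : Measure (ℝ × ℝ) => Real.sqrt (∫ z, cutoff κ (z.1 - z.2) ^ 2 ∂η)) ''
    couplings μ ν)

end TailBoundary

/-!
# Tail boundary flows of sequences that are close in the truncated Wasserstein distance

Choose couplings `ηₖ` of `μₖ` and `νₖ` that are nearly optimal, so that `∑ₖ ∫ T_κ(x - y)² dηₖ` is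
finite, let `z = ((xₖ, yₖ))ₖ` have law `∏ₖ ηₖ`, and let `cₖ` be the mean of `T_κ(xₖ - yₖ)`. By
Kolmogorov's one-series theorem and the Borel-Cantelli lemma, `S(z) = ∑ₖ (xₖ - yₖ - cₖ)` converges
almost surely (`ae_exists_tendsto_sum_sub`). The maps `p(t, z) = (t, x)` and
`q(t, z) = (t + S(z), y)` from `ℝ × (ℝ²)^ℕ` onto the two path spaces preserve the measures and
commute with translation, so composition with them is injective, and it suffices that the two tail
boundaries have the same image: for every `F` in the tail boundary of `μ` there is a `G` in that of
`ν` with `F ∘ p = G ∘ q`, and conversely. The converse follows by exchanging the coordinates of the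
couplings.

To find `G`, consider `H(t, z) = F(t - S(z), x)`. Writing `F = Fₙ ∘ πₙ` and
`S(z) = ∑_{k < n} (xₖ - yₖ - cₖ) + Rₙ(zₙ, zₙ₊₁, …)`, the sum of the first `n` of the `xₖ` cancels:
`H(t, z) = Fₙ(t + ∑_{k < n} (yₖ + cₖ) - Rₙ(zₙ, …), (xₙ, …))`. Hence, for every `n`, `H` depends only
on `t`, on `y` and on `xₙ, xₙ₊₁, …`. Conditionally on `y` the `xₖ` are independent, so the zero-one
law shows that `H` is a function `G(t, y)`. To avoid conditional measures on the infinite product,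
`xₖ` is written as `fₖ(yₖ, uₖ)` with independent uniform `uₖ` (`exists_measurePreserving_uniform`);
then the zero-one law is applied to the variable `u` for fixed `(t, y)`, and `G(t, y)` is the
integral of `H` over `u`. Integrating the formula above over `u` shows that `G` is a tail function.
This is `exists_isTail_of_coupling`.
-/

namespace TailBoundary

open ProbabilityTheory Filter
open scoped Topology unitInterval

/-! ### Infinite product measures -/

section ProductMeasures

variable {X Y : Type*} [MeasurableSpace X] [MeasurableSpace Y]

theorem measurePreserving_infinitePi_shift (η : ℕ → Measure X) [∀ k, IsProbabilityMeasure (η k)]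
    (n : ℕ) :
    MeasurePreserving (fun (z : ℕ → X) k => z (n + k)) (infinitePi η)
      (infinitePi fun k => η (n + k)) :=
  ⟨by fun_prop, map_infinitePi_infinitePi_of_inj (add_right_injective n)⟩

theorem measurePreserving_infinitePi_map {η : ℕ → Measure X} {ν : ℕ → Measure Y}
    [∀ k, IsProbabilityMeasure (η k)] [∀ k, IsProbabilityMeasure (ν k)] {f : ℕ → X → Y}
    (hf : ∀ k, MeasurePreserving (f k) (η k) (ν k)) :
    MeasurePreserving (fun (z : ℕ → X) k => f k (z k)) (infinitePi η) (infinitePi ν) := by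
  have hm : ∀ k, Measurable (f k) := fun k => (hf k).measurable
  refine ⟨by fun_prop, ?_⟩
  rw [infinitePi_map_pi _ hm]
  simp only [(hf _).map_eq]

theorem measurePreserving_infinitePi_zip (ν : ℕ → Measure X) (ρ : ℕ → Measure Y)
    [∀ k, IsProbabilityMeasure (ν k)] [∀ k, IsProbabilityMeasure (ρ k)] :
    MeasurePreserving (fun (p : (ℕ → X) × (ℕ → Y)) k => (p.1 k, p.2 k))
      ((infinitePi ν).prod (infinitePi ρ)) (infinitePi fun k => (ν k).prod (ρ k)) := by
  have hm : Measurable fun (p : (ℕ → X) × (ℕ → Y)) k => (p.1 k, p.2 k) := by fun_prop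
  refine ⟨hm, IsProjectiveLimit.unique (P := fun J : Finset ℕ =>
    Measure.pi fun i : J => (ν i).prod (ρ i)) (fun J => ?_) (isProjectiveLimit_infinitePi _)⟩
  rw [Measure.map_map (by fun_prop) hm]
  have h := (measurePreserving_arrowProdEquivProdArrow X Y J (fun i => ν i) (fun i => ρ i)).symm
  change _ = Measure.pi fun i : J => (ν i).prod (ρ i)
  rw [← h.map_eq, ← infinitePi_map_restrict (μ := ν), ← infinitePi_map_restrict (μ := ρ),
    Measure.map_prod_map _ _ (by fun_prop) (by fun_prop), Measure.map_map (by fun_prop) (by fun_prop)]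
  rfl

/-- Kolmogorov's zero-one law for functions: if, up to null sets, `h` does not depend on the first
`n` coordinates, for every `n`, then `h` is almost everywhere constant. -/
theorem ae_eq_integral_of_forall_ae_eq_shift {ρ : ℕ → Measure X}
    [∀ k, IsProbabilityMeasure (ρ k)] {h : (ℕ → X) → ℝ} (hm : Measurable h)
    (hi : Integrable h (infinitePi ρ))
    (ht : ∀ n, ∃ g : (ℕ → X) → ℝ, Measurable g ∧
      h =ᵐ[infinitePi ρ] fun u => g fun k => u (n + k)) :
    h =ᵐ[infinitePi ρ] fun _ => ∫ u, h u ∂infinitePi ρ := by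
  let m : ℕ → MeasurableSpace (ℕ → X) := fun i => MeasurableSpace.comap (fun u => u i) inferInstance
  have hle : ∀ i, m i ≤ MeasurableSpace.pi := fun i => (measurable_pi_apply i).comap_le
  have hindep : iIndep m (infinitePi ρ) :=
    iIndepFun_infinitePi (P := ρ) (X := fun _ x => x) (fun _ => measurable_id)
  -- the σ-algebra of the coordinates before the `n`-th
  let ℱ : Filtration ℕ (MeasurableSpace.pi : MeasurableSpace (ℕ → X)) :=
    { seq := fun n => ⨆ i ∈ Set.Iio n, m i
      mono' := fun a b hab => biSup_mono fun i hi => lt_of_lt_of_le hi hab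
      le' := fun n => iSup₂_le fun i _ => hle i }
  have hsup : (⨆ n, ℱ n) = MeasurableSpace.pi := by
    refine le_antisymm (iSup_le fun n => ℱ.le n) (iSup_le fun i => ?_)
    exact (le_iSup₂_of_le (f := fun j (_ : j ∈ Set.Iio (i + 1)) => m j) i (Nat.lt_succ_self i)
      le_rfl).trans (le_iSup (fun n => ℱ n) (i + 1))
  have hcond : ∀ n, (infinitePi ρ)[h | ℱ n] =ᵐ[infinitePi ρ] fun _ => ∫ u, h u ∂infinitePi ρ := by
    intro n
    obtain ⟨g, hg, hgn⟩ := ht n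
    have hgm : Measurable[⨆ i ∈ Set.Ici n, m i] fun u : ℕ → X => g fun k => u (n + k) := by
      refine hg.comp (@measurable_pi_lambda _ _ _ (_) _ _ fun k => ?_)
      exact (comap_measurable (m := inferInstance) (fun u : ℕ → X => u (n + k))).mono
        (le_iSup₂_of_le (f := fun j (_ : j ∈ Set.Ici n) => m j) (n + k) (Nat.le_add_right n k)
          le_rfl) le_rfl
    have hd : Disjoint (Set.Ici n) (Set.Iio n) := by
      rw [Set.disjoint_left]
      exact fun i (hi : n ≤ i) (hi' : i < n) => absurd hi (not_le.2 hi')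
    have h1 := condExp_indep_eq (iSup₂_le fun i _ => hle i) (ℱ.le n) hgm.stronglyMeasurable
      (indep_iSup_of_disjoint hle hindep hd)
    have h2 : ∫ u, h u ∂infinitePi ρ = ∫ u, g (fun k => u (n + k)) ∂infinitePi ρ :=
      integral_congr_ae hgn
    rw [h2]
    exact (condExp_congr_ae hgn).trans h1
  have hlim := hi.tendsto_ae_condExp (ℱ := ℱ) (by
    have := hm.stronglyMeasurable
    rwa [← hsup] at this)
  filter_upwards [hlim, ae_all_iff.2 hcond] with u h1 h2
  simp only [h2] at h1
  exact tendsto_nhds_unique h1 tendsto_const_nhds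

theorem ae_eq_integral_of_forall_ae_eq_shift_complex {ρ : ℕ → Measure X}
    [∀ k, IsProbabilityMeasure (ρ k)] {h : (ℕ → X) → ℂ} (hm : Measurable h)
    (hi : Integrable h (infinitePi ρ))
    (ht : ∀ n, ∃ g : (ℕ → X) → ℂ, Measurable g ∧
      h =ᵐ[infinitePi ρ] fun u => g fun k => u (n + k)) :
    h =ᵐ[infinitePi ρ] fun _ => ∫ u, h u ∂infinitePi ρ := by
  have hre := ae_eq_integral_of_forall_ae_eq_shift (Complex.measurable_re.comp hm) hi.re fun n => by
    obtain ⟨g, hg, hgn⟩ := ht n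
    exact ⟨_, Complex.measurable_re.comp hg, hgn.fun_comp Complex.re⟩
  have him := ae_eq_integral_of_forall_ae_eq_shift (Complex.measurable_im.comp hm) hi.im fun n => by
    obtain ⟨g, hg, hgn⟩ := ht n
    exact ⟨_, Complex.measurable_im.comp hg, hgn.fun_comp Complex.im⟩
  filter_upwards [hre, him] with u h1 h2
  exact Complex.ext (h1.trans (integral_re hi)) (h2.trans (integral_im hi))

/-- A measure on a product is the law of `(f (y, u), y)` for a measurable `f`, where `y` is
distributed as the second marginal and `u` is an independent uniform variable on `[0, 1]`. -/
theorem exists_measurePreserving_uniform [StandardBorelSpace X] [Nonempty X]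
    {η : Measure (X × Y)} {ν : Measure Y} [IsProbabilityMeasure η]
    (h : MeasurePreserving Prod.snd η ν) :
    ∃ f : Y × I → X, Measurable f ∧
      MeasurePreserving (fun p : Y × I => (f p, p.1)) (ν.prod volume) η := by
  have : IsProbabilityMeasure (η.map Prod.swap) := isProbabilityMeasure_map (by fun_prop)
  have hfst : (η.map Prod.swap).fst = ν := by rw [Measure.fst_map_swap, Measure.snd, h.map_eq]
  obtain ⟨f, hf, hfκ⟩ := (η.map Prod.swap).condKernel.exists_measurable_map_eq_unitInterval
  have hf' : Measurable fun p : Y × I => f p.1 p.2 := hf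
  refine ⟨fun p => f p.1 p.2, hf', by fun_prop, ?_⟩
  have hd := (η.map Prod.swap).disintegrate (η.map Prod.swap).condKernel
  rw [hfst] at hd
  have key : (ν.prod volume).map (fun p : Y × I => (p.1, f p.1 p.2)) = η.map Prod.swap := by
    rw [← hd]
    have : IsProbabilityMeasure ν := hfst ▸ inferInstance
    ext s hs
    rw [Measure.map_apply (by fun_prop) hs, Measure.compProd_apply hs,
      Measure.prod_apply (measurableSet_preimage (by fun_prop) hs)]
    refine lintegral_congr fun y => ?_
    rw [← hfκ y, Measure.map_apply (by fun_prop) (by measurability)]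
    rfl
  have h2 := congrArg (Measure.map Prod.swap) key
  rw [Measure.map_map (by fun_prop) (by fun_prop), Measure.map_map (by fun_prop) (by fun_prop)] at h2
  simpa [Function.comp_def] using h2

end ProductMeasures

/-! ### Convergence of the compensated sum of differences -/

section Convergence

/-- Kolmogorov's one-series theorem: a series of independent centred random variables with summable
variances converges almost surely. -/
theorem ae_exists_tendsto_sum_of_summable_variance {Ω : Type*} [MeasurableSpace Ω] {P : Measure Ω}
    [IsProbabilityMeasure P] {X : ℕ → Ω → ℝ} (hX : ∀ k, Measurable (X k))
    (h2 : ∀ k, MemLp (X k) 2 P) (h0 : ∀ k, ∫ ω, X k ω ∂P = 0) (hind : iIndepFun X P)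
    (hs : Summable fun k => variance (X k) P) :
    ∀ᵐ ω ∂P, ∃ l, Tendsto (fun n => ∑ k ∈ Finset.range n, X k ω) atTop (𝓝 l) := by
  let ℱ := Filtration.natural X fun k => (hX k).stronglyMeasurable
  let S : ℕ → Ω → ℝ := fun n => ∑ k ∈ Finset.range (n + 1), X k
  have hS2 : ∀ n, MemLp (S n) 2 P := fun n => memLp_finsetSum' _ fun k _ => h2 k
  have hSi : ∀ n, Integrable (S n) P := fun n => (hS2 n).integrable (by norm_num)
  have hmart : Martingale S ℱ P := by
    refine martingale_of_condExp_sub_eq_zero_nat (fun n => ?_) hSi fun n => ?_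
    · refine Finset.stronglyMeasurable_sum _ fun k hk => ?_
      have hk' : k ≤ n := Nat.lt_succ_iff.1 (Finset.mem_range.1 hk)
      exact ((Filtration.stronglyAdapted_natural fun k => (hX k).stronglyMeasurable) k).mono
        (ℱ.mono hk')
    · have : S (n + 1) - S n = X (n + 1) := by
        simp only [S, Finset.sum_range_succ _ (n + 1), add_sub_cancel_left]
      rw [this]
      refine (hind.condExp_natural_ae_eq_of_lt (fun k => (hX k).stronglyMeasurable)
        (Nat.lt_succ_self n)).trans (Eventually.of_forall fun ω => ?_)
      simp [h0]
  have hvar : ∀ n, ∫ ω, S n ω ^ 2 ∂P ≤ ∑' k, variance (X k) P := by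
    intro n
    have hmean : ∫ ω, S n ω ∂P = 0 := by
      simp only [S, Finset.sum_apply]
      rw [integral_finsetSum _ fun k _ => (h2 k).integrable (by norm_num)]
      simp [h0]
    rw [← variance_of_integral_eq_zero (hSi n).aemeasurable hmean,
      IndepFun.variance_sum (fun k _ => h2 k) fun i _ j _ hij => hind.indepFun hij]
    exact hs.sum_le_tsum _ fun k _ => variance_nonneg _ _
  have hbdd : ∀ n, eLpNorm (S n) 1 P ≤ (1 + ∑' k, variance (X k) P).toNNReal := by
    intro n
    rw [eLpNorm_one_eq_lintegral_enorm, ← ofReal_integral_norm_eq_lintegral_enorm (hSi n)]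
    refine ENNReal.ofReal_le_ofReal ?_
    have hsq : Integrable (fun ω => S n ω ^ 2) P := (hS2 n).integrable_sq
    calc ∫ ω, ‖S n ω‖ ∂P ≤ ∫ ω, (1 + S n ω ^ 2) ∂P := by
          refine integral_mono (hSi n).norm ((integrable_const 1).add hsq) fun ω => ?_
          simp only [Real.norm_eq_abs]
          nlinarith [sq_abs (S n ω), sq_nonneg (|S n ω| - 1), abs_nonneg (S n ω)]
      _ = 1 + ∫ ω, S n ω ^ 2 ∂P := by
          rw [integral_add (integrable_const 1) hsq]
          simp
      _ ≤ _ := by linarith [hvar n]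
  filter_upwards [hmart.submartingale.exists_ae_tendsto_of_bdd hbdd] with ω ⟨l, hl⟩
  refine ⟨l, (tendsto_add_atTop_iff_nat 1).1 ?_⟩
  simpa [S] using hl

theorem measurable_cutoff (κ : ℝ) : Measurable (cutoff κ) := by
  unfold cutoff
  fun_prop

theorem abs_cutoff_le {κ : ℝ} (hκ : 0 < κ) (x : ℝ) : |cutoff κ x| ≤ κ :=
  abs_le.2 ⟨le_max_left _ _, max_le (by linarith) (min_le_right _ _)⟩

theorem cutoff_eq_self {κ x : ℝ} (h : |x| < κ) : cutoff κ x = x := by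
  rw [cutoff, min_eq_left (abs_lt.1 h).2.le, max_eq_right (abs_lt.1 h).1.le]

theorem sq_cutoff_of_le_abs {κ x : ℝ} (hκ : 0 < κ) (h : κ ≤ |x|) : cutoff κ x ^ 2 = κ ^ 2 := by
  rcases le_abs.1 h with h | h
  · rw [cutoff, min_eq_right h, max_eq_right (by linarith)]
  · rw [cutoff, min_eq_left (by linarith), max_eq_left (by linarith), neg_sq]

/-- If `∑ₖ ∫ T_κ(x - y)² dηₖ` is finite, the sum of the differences `xₖ - yₖ`, compensated by the
means of their cutoffs, converges almost surely: by the Borel-Cantelli lemma only finitely many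
differences are changed by the cutoff. -/
theorem ae_exists_tendsto_sum_sub {κ : ℝ} (hκ : 0 < κ) (η : ℕ → Measure (ℝ × ℝ))
    [∀ k, IsProbabilityMeasure (η k)]
    (hs : Summable fun k => ∫ w, cutoff κ (w.1 - w.2) ^ 2 ∂η k) :
    ∀ᵐ z ∂infinitePi η, ∃ l, Tendsto (fun n => ∑ k ∈ Finset.range n,
      ((z k).1 - (z k).2 - ∫ w, cutoff κ (w.1 - w.2) ∂η k)) atTop (𝓝 l) := by
  let c : ℕ → ℝ := fun k => ∫ w, cutoff κ (w.1 - w.2) ∂η k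
  let T : ℝ × ℝ → ℝ := fun w => cutoff κ (w.1 - w.2)
  have hT : Measurable T := (measurable_cutoff κ).comp (by fun_prop)
  have hTL : ∀ k, MemLp T 2 (η k) := fun k => MemLp.of_bound hT.aestronglyMeasurable κ
    (Eventually.of_forall fun w => abs_cutoff_le hκ _)
  have hev : ∀ k, MeasurePreserving (fun z : ℕ → ℝ × ℝ => z k) (infinitePi η) (η k) :=
    fun k => measurePreserving_eval_infinitePi η k
  let X : ℕ → (ℕ → ℝ × ℝ) → ℝ := fun k z => T (z k) - c k
  have hX : ∀ k, Measurable (X k) := fun k => (hT.comp (measurable_pi_apply k)).sub_const _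
  have hconv : ∀ᵐ z ∂infinitePi η,
      ∃ l, Tendsto (fun n => ∑ k ∈ Finset.range n, X k z) atTop (𝓝 l) := by
    refine ae_exists_tendsto_sum_of_summable_variance hX (fun k => ?_) (fun k => ?_) ?_ ?_
    · exact ((hTL k).comp_measurePreserving (hev k)).sub (memLp_const _)
    · have h1 : ∫ z, T (z k) ∂infinitePi η = c k := by
        conv_rhs => simp only [c]
        rw [← (hev k).map_eq, integral_map (hev k).aemeasurable hT.aestronglyMeasurable]
      have hTi : Integrable (fun z => T (z k)) (infinitePi η) :=
        ((hTL k).comp_measurePreserving (hev k)).integrable (by norm_num)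
      simp only [X]
      rw [integral_sub hTi (integrable_const _), h1]
      simp
    · exact iIndepFun_infinitePi (P := η) (X := fun k w => T w - c k)
        fun k => hT.sub_const _
    · refine Summable.of_nonneg_of_le (fun k => variance_nonneg _ _) (fun k => ?_) hs
      have hv : variance (X k) (infinitePi η) = variance T (η k) :=
        (variance_sub_const (X := fun z : ℕ → ℝ × ℝ => T (z k))
          (hT.comp (measurable_pi_apply k)).aestronglyMeasurable (c k)).trans
          ((hev k).variance_fun_comp hT.aemeasurable)
      rw [hv]
      exact variance_le_expectation_sq hT.aestronglyMeasurable
  have hBC : ∀ᵐ z ∂infinitePi η, ∀ᶠ k in atTop, |(z k).1 - (z k).2| < κ := by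
    have hle : ∀ k, infinitePi η {z | κ ≤ |(z k).1 - (z k).2|} ≤
        ENNReal.ofReal ((∫ w, T w ^ 2 ∂η k) / κ ^ 2) := by
      intro k
      have hset : MeasurableSet {w : ℝ × ℝ | κ ≤ |w.1 - w.2|} :=
        measurableSet_le measurable_const (by fun_prop)
      have h1 : infinitePi η {z | κ ≤ |(z k).1 - (z k).2|} = η k {w | κ ≤ |w.1 - w.2|} :=
        (hev k).measure_preimage hset.nullMeasurableSet
      have h2 : {w : ℝ × ℝ | κ ≤ |w.1 - w.2|} ⊆ {w | κ ^ 2 ≤ T w ^ 2} :=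
        fun w hw => (sq_cutoff_of_le_abs hκ hw).ge
      have h3 := mul_meas_ge_le_integral_of_nonneg (μ := η k) (f := fun w => T w ^ 2)
        (Eventually.of_forall fun w => sq_nonneg _) (hTL k).integrable_sq (κ ^ 2)
      rw [h1]
      refine (measure_mono h2).trans ?_
      rw [← ofReal_measureReal]
      refine ENNReal.ofReal_le_ofReal ((le_div_iff₀ (by positivity)).2 ?_)
      linarith
    have hsum : ∑' k, infinitePi η {z | κ ≤ |(z k).1 - (z k).2|} ≠ ⊤ :=
      ne_top_of_le_ne_top (hs.div_const _).tsum_ofReal_ne_top (ENNReal.tsum_le_tsum hle)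
    filter_upwards [ae_eventually_notMem hsum] with z hz
    filter_upwards [hz] with k hk
    exact not_le.1 hk
  filter_upwards [hconv, hBC] with z ⟨l, hl⟩ hz
  obtain ⟨N, hN⟩ := eventually_atTop.1 hz
  -- from the index `N` on the two series have the same terms
  refine ⟨l + ∑ k ∈ Finset.range N, ((z k).1 - (z k).2 - c k - X k z), ?_⟩
  refine (hl.add_const (∑ k ∈ Finset.range N, ((z k).1 - (z k).2 - c k - X k z))).congr' ?_
  filter_upwards [eventually_ge_atTop N] with n hn
  have h0 : ∑ k ∈ Finset.range N, ((z k).1 - (z k).2 - c k - X k z) =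
      ∑ k ∈ Finset.range n, ((z k).1 - (z k).2 - c k - X k z) := by
    refine Finset.sum_subset (Finset.range_mono hn) fun k _ hk => ?_
    simp only [X, T, cutoff_eq_self (hN k (by simpa using hk)), sub_self]
  rw [h0, ← Finset.sum_add_distrib]
  exact Finset.sum_congr rfl fun k _ => by simp [c]

end Convergence

/-! ### Transfer of tail functions along a coupling -/

section Transfer

theorem measurable_walk (n : ℕ) : Measurable (walk n) := by
  unfold walk
  fun_prop

/-- The functions whose class modulo null sets lies in the tail boundary: for every `n`, `F` is
almost everywhere a measurable function of `walk n`, bounded everywhere. -/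
def IsTail (μ : ℕ → Measure ℝ) [∀ k, IsProbabilityMeasure (μ k)] (F : ℝ × (ℕ → ℝ) → ℂ) : Prop :=
  ∀ n, ∃ g : ℝ × (ℕ → ℝ) → ℂ, Measurable g ∧ (∃ C : ℝ, ∀ x, ‖g x‖ ≤ C) ∧
    F =ᵐ[pathMeasure μ] g ∘ walk n

/-- The product of Lebesgue measure with the coupling `∏ₖ ηₖ` of the increments. -/
noncomputable def couplingMeasure (η : ℕ → Measure (ℝ × ℝ)) [∀ k, IsProbabilityMeasure (η k)] :
    Measure (ℝ × (ℕ → ℝ × ℝ)) :=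
  (volume : Measure ℝ).prod (infinitePi η)

theorem measurePreserving_add_map {η : ℕ → Measure (ℝ × ℝ)} {μ : ℕ → Measure ℝ}
    [∀ k, IsProbabilityMeasure (η k)] [∀ k, IsProbabilityMeasure (μ k)] {f : ℝ × ℝ → ℝ}
    (hf : ∀ k, MeasurePreserving f (η k) (μ k)) {S : (ℕ → ℝ × ℝ) → ℝ} (hS : Measurable S) :
    MeasurePreserving (fun p : ℝ × (ℕ → ℝ × ℝ) => (p.1 + S p.2, fun k => f (p.2 k)))
      (couplingMeasure η) (pathMeasure μ) := by
  have h := (measurePreserving_infinitePi_map hf).skew_product (μc := (volume : Measure ℝ))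
    (μd := (volume : Measure ℝ)) (g := fun z t => t + S z)
    (by simp only [Function.uncurry_def]; fun_prop)
    (Filter.Eventually.of_forall fun z => (measurePreserving_add_right volume _).map_eq)
  exact (measurePreserving_swap.comp h).comp measurePreserving_swap

/-- `S` behaves like the sum `∑ₖ (xₖ - yₖ - cₖ)`: for every `n`, it is almost everywhere the sum of the
first `n` terms and a measurable function of the other increments. This is all that is used of the
sum, and, unlike convergence, it requires no choice of a value where the series diverges. -/
def IsCompensatedSum (η : ℕ → Measure (ℝ × ℝ)) [∀ k, IsProbabilityMeasure (η k)] (c : ℕ → ℝ)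
    (S : (ℕ → ℝ × ℝ) → ℝ) : Prop :=
  ∀ n, ∃ R : (ℕ → ℝ × ℝ) → ℝ, Measurable R ∧ ∀ᵐ z ∂infinitePi η,
    S z = ∑ k ∈ Finset.range n, ((z k).1 - (z k).2 - c k) + R fun k => z (n + k)

/-- A tail function `F` for `μ`, moved to the coupling by `(t, z) ↦ (t - S(z), x)`, is a tail function
of `(t, y)` for `ν`. Given `(t, y)`, the remaining randomness is a sequence of independent uniform
variables, and the transported function does not depend on the first `n` of them, for every `n`, so
that it is almost surely equal to its mean. -/
theorem exists_isTail_of_coupling {η : ℕ → Measure (ℝ × ℝ)} {μ ν : ℕ → Measure ℝ}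
    [∀ k, IsProbabilityMeasure (η k)] [∀ k, IsProbabilityMeasure (μ k)]
    [∀ k, IsProbabilityMeasure (ν k)] (hfst : ∀ k, MeasurePreserving Prod.fst (η k) (μ k))
    (hsnd : ∀ k, MeasurePreserving Prod.snd (η k) (ν k)) {c : ℕ → ℝ} {S : (ℕ → ℝ × ℝ) → ℝ}
    (hSm : Measurable S) (hS : IsCompensatedSum η c S) {F : ℝ × (ℕ → ℝ) → ℂ} (hF : IsTail μ F) :
    ∃ G : ℝ × (ℕ → ℝ) → ℂ, Measurable G ∧ IsTail ν G ∧ ∀ᵐ p ∂couplingMeasure η,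
      F (p.1 - S p.2, fun k => (p.2 k).1) = G (p.1, fun k => (p.2 k).2) := by
  choose g hgm hgb hg using hF
  choose R hRm hR using hS
  let ρ : ℕ → Measure I := fun _ => volume
  let P : ℝ × (ℕ → ℝ × ℝ) → ℝ × (ℕ → ℝ) := fun p => (p.1 - S p.2, fun k => (p.2 k).1)
  have hP : MeasurePreserving P (couplingMeasure η) (pathMeasure μ) := by
    simpa only [P, sub_eq_add_neg, Pi.neg_apply] using measurePreserving_add_map hfst hSm.neg
  let H : ℝ × (ℕ → ℝ × ℝ) → ℂ := fun p => g 0 (walk 0 (P p))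
  have hHm : Measurable H := (hgm 0).comp ((measurable_walk 0).comp hP.measurable)
  have hFH : ∀ᵐ p ∂couplingMeasure η, F (P p) = H p := hP.quasiMeasurePreserving.ae (hg 0)
  -- `H`, written as a function of `t`, of the first `n` of the `yₖ`, and of the other increments
  let L : ℕ → ℝ × (ℕ → ℝ × ℝ) → ℂ := fun n q =>
    g n (q.1 + ∑ k ∈ Finset.range n, c k - R n q.2, fun k => (q.2 k).1)
  have hLm : ∀ n, Measurable (L n) := fun n => (hgm n).comp (by have := hRm n; fun_prop)
  have hHL : ∀ᵐ p ∂couplingMeasure η, ∀ n, H p =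
      L n (p.1 + ∑ k ∈ Finset.range n, (p.2 k).2, fun k => p.2 (n + k)) := by
    refine ae_all_iff.2 fun n => ?_
    filter_upwards [hFH, hP.quasiMeasurePreserving.ae (hg n),
      quasiMeasurePreserving_snd.ae (hR n)] with p h1 h2 h3
    rw [← h1, h2]
    simp only [Function.comp, walk, P, L, h3]
    refine congrArg (g n) (Prod.ext ?_ rfl)
    simp only [Finset.sum_sub_distrib]
    ring
  choose f hfm hf using fun k => exists_measurePreserving_uniform (hsnd k)
  let Φ : ℕ → (ℕ → ℝ) × (ℕ → I) → ℕ → ℝ × ℝ := fun n q k => (f (n + k) (q.1 k, q.2 k), q.1 k)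
  have hΦm : ∀ n, Measurable (Φ n) := fun n =>
    measurable_pi_lambda _ fun k => ((hfm (n + k)).comp (by fun_prop)).prodMk (by fun_prop)
  have hΦ : MeasurePreserving (Φ 0) ((infinitePi ν).prod (infinitePi ρ)) (infinitePi η) := by
    have := (measurePreserving_infinitePi_map hf).comp (measurePreserving_infinitePi_zip ν ρ)
    simpa only [Φ, zero_add, Function.comp_def] using this
  let Ψ : (ℝ × (ℕ → ℝ)) × (ℕ → I) → ℝ × (ℕ → ℝ × ℝ) := fun q => (q.1.1, Φ 0 (q.1.2, q.2))
  have hΨ : MeasurePreserving Ψ ((pathMeasure ν).prod (infinitePi ρ)) (couplingMeasure η) :=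
    ((MeasurePreserving.id volume).prod hΦ).comp
      (measurePreserving_prodAssoc volume (infinitePi ν) (infinitePi ρ))
  have hgood : ∀ᵐ x ∂pathMeasure ν, ∀ᵐ u ∂infinitePi ρ, ∀ n, H (Ψ (x, u)) =
      L n ((walk n x).1, Φ n ((walk n x).2, fun k => u (n + k))) := by
    have h : ∀ᵐ q ∂(pathMeasure ν).prod (infinitePi ρ), ∀ n, H (Ψ q) =
        L n ((walk n q.1).1, Φ n ((walk n q.1).2, fun k => q.2 (n + k))) := by
      filter_upwards [hΨ.quasiMeasurePreserving.ae hHL] with q hq n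
      rw [hq n]
      simp only [Ψ, Φ, walk, zero_add]
    exact ae_ae_of_ae_prod h
  have hHb : ∃ C : ℝ, ∀ p, ‖H p‖ ≤ C := (hgb 0).imp fun C hC p => hC _
  obtain ⟨C, hC⟩ := hHb
  let G : ℝ × (ℕ → ℝ) → ℂ := fun x => ∫ u, H (Ψ (x, u)) ∂infinitePi ρ
  have hGm : Measurable G :=
    ((hHm.comp hΨ.measurable).stronglyMeasurable.integral_prod_right').measurable
  refine ⟨G, hGm, fun n => ?_, ?_⟩
  · refine ⟨fun x => ∫ u, L n (x.1, Φ n (x.2, fun k => u (n + k))) ∂infinitePi ρ, ?_, ?_, ?_⟩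
    · have : Measurable fun q : (ℝ × (ℕ → ℝ)) × (ℕ → I) =>
          L n (q.1.1, Φ n (q.1.2, fun k => q.2 (n + k))) :=
        (hLm n).comp ((by fun_prop : Measurable fun q : (ℝ × (ℕ → ℝ)) × (ℕ → I) => q.1.1).prodMk
          ((hΦm n).comp (by fun_prop)))
      exact (this.stronglyMeasurable.integral_prod_right').measurable
    · obtain ⟨D, hD⟩ := hgb n
      refine ⟨D, fun x => ?_⟩
      simpa using norm_integral_le_of_norm_le_const (μ := infinitePi ρ) (C := D)
        (Eventually.of_forall fun u => hD _)
    · filter_upwards [hgood] with x hx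
      exact integral_congr_ae (hx.mono fun u hu => hu n)
  · have hconst : ∀ᵐ x ∂pathMeasure ν, ∀ᵐ u ∂infinitePi ρ, H (Ψ (x, u)) = G x := by
      filter_upwards [hgood] with x hx
      have hm : Measurable fun u => H (Ψ (x, u)) :=
        hHm.comp (hΨ.measurable.comp measurable_prodMk_left)
      refine ae_eq_integral_of_forall_ae_eq_shift_complex hm
        (Integrable.of_bound hm.aestronglyMeasurable C (Eventually.of_forall fun u => hC _))
        fun n => ⟨fun u => L n ((walk n x).1, Φ n ((walk n x).2, u)), ?_, hx.mono fun u hu => hu n⟩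
      exact (hLm n).comp (measurable_const.prodMk ((hΦm n).comp measurable_prodMk_left))
    have hmeas : MeasurableSet {p : ℝ × (ℕ → ℝ × ℝ) | H p = G (p.1, fun k => (p.2 k).2)} :=
      measurableSet_eq_fun hHm (hGm.comp (by fun_prop))
    have hprod : ∀ᵐ q ∂(pathMeasure ν).prod (infinitePi ρ),
        H (Ψ q) = G ((Ψ q).1, fun k => ((Ψ q).2 k).2) :=
      (Measure.ae_prod_iff_ae_ae (hΨ.measurable hmeas)).2 hconst
    rw [← hΨ.map_eq] at hFH ⊢
    filter_upwards [hFH, (ae_map_iff hΨ.aemeasurable hmeas).2 hprod] with p h1 h2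
    exact h1.trans h2

end Transfer

/-! ### The tail boundary as an algebra of classes of functions -/

section Classes

theorem IsTail.congr {μ : ℕ → Measure ℝ} [∀ k, IsProbabilityMeasure (μ k)]
    {F G : ℝ × (ℕ → ℝ) → ℂ} (hF : IsTail μ F) (h : G =ᵐ[pathMeasure μ] F) : IsTail μ G :=
  fun n => (hF n).imp fun _ hg => ⟨hg.1, hg.2.1, h.trans hg.2.2⟩

/-- A class modulo null sets lies in the tail boundary if and only if its representatives are tail
functions. -/
theorem mem_tailBoundary_iff {μ : ℕ → Measure ℝ} [∀ k, IsProbabilityMeasure (μ k)]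
    {F : (ℝ × (ℕ → ℝ)) →ₘ[pathMeasure μ] ℂ} : F ∈ tailBoundary μ ↔ IsTail μ F := by
  refine StarSubalgebra.mem_iInf.trans (forall_congr' fun n => ?_)
  have hw := (measurePreserving_walk μ n).quasiMeasurePreserving
  constructor
  · rintro ⟨G, ⟨C, hC⟩, rfl⟩
    -- truncating a bounded class gives a representative that is bounded everywhere
    have hs : MeasurableSet {x | ‖G x‖ ≤ C} := measurableSet_le G.measurable.norm measurable_const
    refine ⟨{x | ‖G x‖ ≤ C}.indicator G, G.measurable.indicator hs,
      ⟨|C|, fun x => ?_⟩, ?_⟩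
    · by_cases hx : x ∈ {x | ‖G x‖ ≤ C}
      · rw [Set.indicator_of_mem hx]
        exact le_trans hx (le_abs_self C)
      · rw [Set.indicator_of_notMem hx, norm_zero]
        exact abs_nonneg C
    · filter_upwards [AEEqFun.coeFn_compQuasiMeasurePreserving G hw, hw.ae hC] with x h1 h2
      exact h1.trans (Set.indicator_of_mem (s := {x | ‖G x‖ ≤ C}) h2 G).symm
  · rintro ⟨g, hg, ⟨C, hC⟩, h⟩
    refine ⟨AEEqFun.mk g hg.aestronglyMeasurable, ⟨C, ?_⟩, ?_⟩
    · filter_upwards [AEEqFun.coeFn_mk g hg.aestronglyMeasurable] with x hx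
      rw [hx]
      exact hC x
    · refine AEEqFun.ext ((AEEqFun.coeFn_mk _ _).trans h.symm)

theorem pullback_eq_pullback_iff {X Y Z : Type*} [MeasurableSpace X] [MeasurableSpace Y]
    [MeasurableSpace Z] {m : Measure X} {m₁ : Measure Y} {m₂ : Measure Z} {p : X → Y} {q : X → Z}
    (hp : QuasiMeasurePreserving p m m₁) (hq : QuasiMeasurePreserving q m m₂) (F : Y →ₘ[m₁] ℂ)
    (G : Z →ₘ[m₂] ℂ) : pullback p hp F = pullback q hq G ↔ ∀ᵐ x ∂m, F (p x) = G (q x) := by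
  have h1 := AEEqFun.coeFn_compQuasiMeasurePreserving F hp
  have h2 := AEEqFun.coeFn_compQuasiMeasurePreserving G hq
  constructor
  · intro h
    have h3 : (F.compQuasiMeasurePreserving p hp) = G.compQuasiMeasurePreserving q hq := h
    rw [h3] at h1
    exact h1.symm.trans h2
  · intro h
    exact AEEqFun.ext (h1.trans (EventuallyEq.trans h h2.symm))

theorem pullback_injective {X Y : Type*} [MeasurableSpace X] [MeasurableSpace Y] {m : Measure X}
    {m' : Measure Y} {p : X → Y} (hp : MeasurePreserving p m m') :
    Function.Injective (pullback p hp.quasiMeasurePreserving) := by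
  intro F G h
  have h1 := (pullback_eq_pullback_iff _ _ F G).1 h
  have h2 := (ae_map_iff hp.aemeasurable (measurableSet_eq_fun F.measurable G.measurable)).2 h1
  rw [hp.map_eq] at h2
  exact AEEqFun.ext h2

/-- Two subalgebras with the same image under injective homomorphisms are isomorphic. -/
theorem exists_starAlgEquiv_of_image_eq {A B E : Type*} [Ring A] [StarRing A] [Algebra ℂ A]
    [StarModule ℂ A] [Ring B] [StarRing B] [Algebra ℂ B] [StarModule ℂ B] [Ring E] [StarRing E]
    [Algebra ℂ E] {p : A →⋆ₐ[ℂ] E} {q : B →⋆ₐ[ℂ] E} (hp : Function.Injective p)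
    (hq : Function.Injective q) (A₀ : StarSubalgebra ℂ A) (B₀ : StarSubalgebra ℂ B)
    (hpq : ∀ a ∈ A₀, ∃ b ∈ B₀, q b = p a) (hqp : ∀ b ∈ B₀, ∃ a ∈ A₀, p a = q b) :
    ∃ θ : A₀ ≃⋆ₐ[ℂ] B₀, ∀ a : A₀, q (θ a) = p a := by
  have h1 : ∀ a : A₀, ∃ b : B₀, q b = p a := fun a =>
    let ⟨b, hb, h⟩ := hpq a a.2
    ⟨⟨b, hb⟩, h⟩
  have h2 : ∀ b : B₀, ∃ a : A₀, p a = q b := fun b =>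
    let ⟨a, ha, h⟩ := hqp b b.2
    ⟨⟨a, ha⟩, h⟩
  choose f hf using h1
  choose g hg using h2
  refine ⟨{ toFun := f, invFun := g, left_inv := fun a => ?_, right_inv := fun b => ?_,
            map_mul' := fun a b => ?_, map_add' := fun a b => ?_, map_star' := fun a => ?_,
            map_smul' := fun r a => ?_ }, hf⟩
  · exact Subtype.ext (hp ((hg _).trans (hf _)))
  · exact Subtype.ext (hq ((hf _).trans (hg _)))
  · refine Subtype.ext (hq ?_)
    simp [hf]
  · refine Subtype.ext (hq ?_)
    simp [hf]
  · refine Subtype.ext (hq ?_)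
    simp [hf, map_star]
  · refine Subtype.ext (hq ?_)
    simp [hf]

end Classes

/-! ### The isomorphism given by a coupling -/

section Isomorphism

theorem IsCompensatedSum.swap {η : ℕ → Measure (ℝ × ℝ)} [∀ k, IsProbabilityMeasure (η k)]
    {η' : ℕ → Measure (ℝ × ℝ)} [∀ k, IsProbabilityMeasure (η' k)]
    (hη : ∀ k, MeasurePreserving Prod.swap (η' k) (η k)) {c : ℕ → ℝ} {S : (ℕ → ℝ × ℝ) → ℝ}
    (hS : IsCompensatedSum η c S) :
    IsCompensatedSum η' (fun k => -c k) fun z => -S fun k => (z k).swap := by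
  intro n
  obtain ⟨R, hR, h⟩ := hS n
  refine ⟨fun z => -R fun k => (z k).swap, (hR.comp (by fun_prop)).neg, ?_⟩
  filter_upwards [(measurePreserving_infinitePi_map hη).quasiMeasurePreserving.ae h] with z hz
  rw [hz, neg_add, ← Finset.sum_neg_distrib]
  refine congrArg (· + _) (Finset.sum_congr rfl fun k _ => ?_)
  simp only [Prod.fst_swap, Prod.snd_swap]
  ring

/-- The isomorphism sends `F` to the unique `G` with `F(t, x) = G(t + S(z), y)`. It is equivariant
because both sides of this equation are equivariant under translation in `t`. -/
theorem isomorphicTailBoundaryFlows_of_coupling {η : ℕ → Measure (ℝ × ℝ)} {μ ν : ℕ → Measure ℝ}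
    [∀ k, IsProbabilityMeasure (η k)] [∀ k, IsProbabilityMeasure (μ k)]
    [∀ k, IsProbabilityMeasure (ν k)] (hfst : ∀ k, MeasurePreserving Prod.fst (η k) (μ k))
    (hsnd : ∀ k, MeasurePreserving Prod.snd (η k) (ν k)) {c : ℕ → ℝ} {S : (ℕ → ℝ × ℝ) → ℝ}
    (hSm : Measurable S) (hS : IsCompensatedSum η c S) : IsomorphicTailBoundaryFlows μ ν := by
  let p : ℝ × (ℕ → ℝ × ℝ) → ℝ × (ℕ → ℝ) := fun x => (x.1, fun k => (x.2 k).1)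
  let q : ℝ × (ℕ → ℝ × ℝ) → ℝ × (ℕ → ℝ) := fun x => (x.1 + S x.2, fun k => (x.2 k).2)
  have hp : MeasurePreserving p (couplingMeasure η) (pathMeasure μ) := by
    simpa only [p, add_zero] using measurePreserving_add_map hfst (S := fun _ => 0) measurable_const
  have hq : MeasurePreserving q (couplingMeasure η) (pathMeasure ν) :=
    measurePreserving_add_map hsnd hSm
  have hpq : ∀ F ∈ tailBoundary μ, ∃ G ∈ tailBoundary ν,
      pullback q hq.quasiMeasurePreserving G = pullback p hp.quasiMeasurePreserving F := by
    intro F hF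
    obtain ⟨G, hGm, hG, h⟩ :=
      exists_isTail_of_coupling hfst hsnd hSm hS (mem_tailBoundary_iff.1 hF)
    have hmk := AEEqFun.coeFn_mk (μ := pathMeasure ν) G hGm.aestronglyMeasurable
    refine ⟨AEEqFun.mk G hGm.aestronglyMeasurable, mem_tailBoundary_iff.2 (hG.congr hmk),
      (pullback_eq_pullback_iff _ _ _ _).2 ?_⟩
    have hshear : MeasurePreserving (fun x : ℝ × (ℕ → ℝ × ℝ) => (x.1 + S x.2, x.2))
        (couplingMeasure η) (couplingMeasure η) := by
      have h := (MeasurePreserving.id (infinitePi η)).skew_product (μc := (volume : Measure ℝ))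
        (μd := (volume : Measure ℝ)) (g := fun z t => t + S z)
        (by simp only [Function.uncurry_def]; fun_prop)
        (Filter.Eventually.of_forall fun z => (measurePreserving_add_right volume _).map_eq)
      exact (measurePreserving_swap.comp h).comp measurePreserving_swap
    filter_upwards [hq.quasiMeasurePreserving.ae hmk, hshear.quasiMeasurePreserving.ae h]
      with x h1 h2
    rw [h1]
    simpa only [add_sub_cancel_right] using h2.symm
  have hqp : ∀ G ∈ tailBoundary ν, ∃ F ∈ tailBoundary μ,
      pullback p hp.quasiMeasurePreserving F = pullback q hq.quasiMeasurePreserving G := by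
    intro G hG
    let η' : ℕ → Measure (ℝ × ℝ) := fun k => (η k).map Prod.swap
    have : ∀ k, IsProbabilityMeasure (η' k) := fun k =>
      isProbabilityMeasure_map measurable_swap.aemeasurable
    have hs : ∀ k, MeasurePreserving Prod.swap (η k) (η' k) := fun k => ⟨measurable_swap, rfl⟩
    have hs' : ∀ k, MeasurePreserving Prod.swap (η' k) (η k) := fun k =>
      (hs k).symm (MeasurableEquiv.prodComm (α := ℝ) (β := ℝ))
    obtain ⟨F, hFm, hF, h⟩ := exists_isTail_of_coupling (fun k => (hsnd k).comp (hs' k))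
      (fun k => (hfst k).comp (hs' k)) (hSm.comp (by fun_prop)).neg (hS.swap hs')
      (mem_tailBoundary_iff.1 hG)
    have hmk := AEEqFun.coeFn_mk (μ := pathMeasure μ) F hFm.aestronglyMeasurable
    refine ⟨AEEqFun.mk F hFm.aestronglyMeasurable, mem_tailBoundary_iff.2 (hF.congr hmk),
      (pullback_eq_pullback_iff _ _ _ _).2 ?_⟩
    have hswap : MeasurePreserving (fun x : ℝ × (ℕ → ℝ × ℝ) => (x.1, fun k => (x.2 k).swap))
        (couplingMeasure η) (couplingMeasure η') :=
      (MeasurePreserving.id volume).prod (measurePreserving_infinitePi_map hs)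
    filter_upwards [hp.quasiMeasurePreserving.ae hmk, hswap.quasiMeasurePreserving.ae h]
      with x h1 h2
    rw [h1]
    simpa [p, q] using h2.symm
  obtain ⟨θ, hθ⟩ := exists_starAlgEquiv_of_image_eq (pullback_injective hp) (pullback_injective hq)
    (tailBoundary μ) (tailBoundary ν) hpq hqp
  refine ⟨θ, fun s F => Subtype.ext (pullback_injective hq ?_)⟩
  rw [hθ]
  -- both sides are the translate by `s` of `pullback p F = pullback q (θ F)`
  have hτ : MeasurePreserving (fun x : ℝ × (ℕ → ℝ × ℝ) => (x.1 + -s.toAdd, x.2))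
      (couplingMeasure η) (couplingMeasure η) :=
    (measurePreserving_add_right volume (-s.toAdd)).prod (MeasurePreserving.id _)
  have h := congrArg (pullback _ hτ.quasiMeasurePreserving) (hθ F)
  rw [pullback_comp, pullback_comp] at h
  change pullback p _ (pullback (translate (-s.toAdd)) _ F.1) =
    pullback q _ (pullback (translate (-s.toAdd)) _ (θ F).1)
  rw [pullback_comp, pullback_comp]
  refine h.symm.trans (pullback_congr (hq.quasiMeasurePreserving.comp hτ.quasiMeasurePreserving)
    ((measurePreserving_translate ν (-s.toAdd)).quasiMeasurePreserving.comp
      hq.quasiMeasurePreserving) (funext fun x => Prod.ext ?_ rfl) _)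
  simp only [q, translate, Function.comp]
  ring

end Isomorphism

/-! ### The choice of the couplings -/

section Choice

theorem exists_isCompensatedSum {η : ℕ → Measure (ℝ × ℝ)} [∀ k, IsProbabilityMeasure (η k)]
    {κ : ℝ} (hκ : 0 < κ) (hs : Summable fun k => ∫ w, cutoff κ (w.1 - w.2) ^ 2 ∂η k) :
    ∃ S : (ℕ → ℝ × ℝ) → ℝ, Measurable S ∧
      IsCompensatedSum η (fun k => ∫ w, cutoff κ (w.1 - w.2) ∂η k) S := by
  let c : ℕ → ℝ := fun k => ∫ w, cutoff κ (w.1 - w.2) ∂η k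
  obtain ⟨S, hS, hSl⟩ := measurable_limit_of_tendsto_metrizable_ae
    (fun n => Measurable.aemeasurable (by fun_prop)) (ae_exists_tendsto_sum_sub hκ η hs)
  refine ⟨S, hS, fun n => ?_⟩
  have hs' : Summable fun k => ∫ w, cutoff κ (w.1 - w.2) ^ 2 ∂η (n + k) :=
    hs.comp_injective (add_right_injective n)
  obtain ⟨R, hR, hRl⟩ := measurable_limit_of_tendsto_metrizable_ae
    (fun n => Measurable.aemeasurable (by fun_prop))
    (ae_exists_tendsto_sum_sub hκ (fun k => η (n + k)) hs')
  refine ⟨R, hR, ?_⟩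
  filter_upwards [hSl,
    (measurePreserving_infinitePi_shift η n).quasiMeasurePreserving.ae hRl] with z h1 h2
  have h3 := h2.const_add (∑ k ∈ Finset.range n, ((z k).1 - (z k).2 - c k))
  refine tendsto_nhds_unique (h1.comp (tendsto_add_atTop_nat n)) (h3.congr fun m => ?_)
  simp only [Function.comp, add_comm m n, Finset.sum_range_add, c]

theorem wasserstein_nonneg (κ : ℝ) (μ ν : Measure ℝ) : 0 ≤ wasserstein κ μ ν :=
  Real.sInf_nonneg (by rintro _ ⟨η, _, rfl⟩; exact Real.sqrt_nonneg _)

theorem exists_mem_couplings_integral_lt (κ : ℝ) (μ ν : Measure ℝ) [IsProbabilityMeasure μ]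
    [IsProbabilityMeasure ν] {ε : ℝ} (hε : 0 < ε) :
    ∃ η ∈ couplings μ ν, ∫ w, cutoff κ (w.1 - w.2) ^ 2 ∂η < (wasserstein κ μ ν + ε) ^ 2 := by
  have hne : (couplings μ ν).Nonempty := ⟨μ.prod ν, inferInstance, by simp, by simp⟩
  obtain ⟨_, ⟨η, hη, rfl⟩, h⟩ := exists_lt_of_csInf_lt
    (hne.image fun η : Measure (ℝ × ℝ) => Real.sqrt (∫ z, cutoff κ (z.1 - z.2) ^ 2 ∂η))
    (lt_add_of_pos_right (wasserstein κ μ ν) hε)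
  exact ⟨η, hη, (Real.sqrt_lt' (add_pos_of_nonneg_of_pos (wasserstein_nonneg κ μ ν) hε)).1 h⟩

end Choice

end TailBoundary

theorem mainTheorem10 (μ ν : ℕ → Measure ℝ) [∀ n, IsProbabilityMeasure (μ n)]
    [∀ n, IsProbabilityMeasure (ν n)]
    (h : ∃ κ : ℝ, 0 < κ ∧ Summable fun n => TailBoundary.wasserstein κ (μ n) (ν n) ^ 2) :
    TailBoundary.IsomorphicTailBoundaryFlows μ ν := by
  obtain ⟨κ, hκ, hs⟩ := h
  have hε : ∀ n : ℕ, (0 : ℝ) < (1 / 2) ^ n := fun n => by positivity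
  choose η hη hlt using fun n =>
    TailBoundary.exists_mem_couplings_integral_lt κ (μ n) (ν n) (hε n)
  have : ∀ n, IsProbabilityMeasure (η n) := fun n => (hη n).1
  have hsum : Summable fun n => ∫ w, TailBoundary.cutoff κ (w.1 - w.2) ^ 2 ∂η n := by
    have hg : Summable fun n : ℕ => ((1 / 4 : ℝ)) ^ n :=
      summable_geometric_of_lt_one (by norm_num) (by norm_num)
    refine Summable.of_nonneg_of_le (fun n => integral_nonneg fun w => sq_nonneg _) (fun n => ?_)
      ((hs.mul_left 2).add (hg.mul_left 2))
    have h4 : (1 / 4 : ℝ) ^ n = ((1 / 2) ^ n) ^ 2 := by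
      rw [← pow_mul, mul_comm, pow_mul]
      norm_num
    rw [h4]
    nlinarith [hlt n, sq_nonneg (TailBoundary.wasserstein κ (μ n) (ν n) - (1 / 2) ^ n)]
  obtain ⟨S, hS, hc⟩ := TailBoundary.exists_isCompensatedSum hκ hsum
  exact TailBoundary.isomorphicTailBoundaryFlows_of_coupling
    (fun n => ⟨measurable_fst, (hη n).2.1⟩) (fun n => ⟨measurable_snd, (hη n).2.2⟩) hS hc
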